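/- Let $n\ge 3$ and let $\Sigma\subset\{0,1\}^{n\times n}$ be a synchronizing automaton with $n$ states: a set of 0/1 matrices (letters) each of whose rows sums to $1$, such that some finite product of letters equals $e^Te_i$ for some $i$, where $e$ is the all-ones row vector and $e_i$ the $i$-th standard basis row vector. Let $\Sigma^{\le t}$ be the set of products of at most $t$ letters (including the identity matrix). The synchronizing probability function is $$k(t)=\min_{p\in\mathbb R^n_{\ge 0},\ ep^T=1}\ \max_{W\in\Sigma^{\le t},\ 1\le i\le n}(pW)e_i^T ,\qquad t\in\mathbb N,$$ and the triple rendezvous time $T_3$ is the least $t$ such that some matrix in $\Sigma^{\le t}$ has a column with at least three non-zero entries. Then: 1. for every integer $t$ with $1\le t<T_3$ there is an integer $s$ with $0\le s\le n-1$ and $k(t)=\frac{2}{n+s}$; 2. for every integer $s$ with $0\le s\le n-1$, the function $k$ takes the value $\frac{2}{n+s}$ at no more than $\lfloor (n-s)/2\rfloor+1$ consecutive values of $t$, for any block of consecutive values of $t$ that begins before $T_3$; that is, if $t<T_3$ and $k(t)=k(t+1)=\dots=k(t+m-1)=\frac{2}{n+s}$, then $m\le\lfloor (n-s)/2\rfloor+1$.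 -/

import Mathlib

noncomputable section

namespace SyncAutomaton

/-- A (deterministic, complete, finite state) automaton with states `Fin n`, given by its set of
letters: every letter is a 0/1 matrix whose rows sum to one. -/
def IsAutomaton {n : ℕ} (S : Set (Matrix (Fin n) (Fin n) ℝ)) : Prop :=
  ∀ L ∈ S, (∀ i j, L i j = 0 ∨ L i j = 1) ∧ ∀ i, ∑ j, L i j = 1

/-- The products of at most `t` letters; the product of length zero is the identity matrix. -/
def wordsLE {n : ℕ} (S : Set (Matrix (Fin n) (Fin n) ℝ)) (t : ℕ) :
    Set (Matrix (Fin n) (Fin n) ℝ) :=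
  {W | ∃ l : List (Matrix (Fin n) (Fin n) ℝ), (∀ L ∈ l, L ∈ S) ∧ l.length ≤ t ∧ l.prod = W}

/-- Some finite product of letters is `eᵀ eᵢ`: it maps all states to the single state `i`. -/
def IsSynchronizing {n : ℕ} (S : Set (Matrix (Fin n) (Fin n) ℝ)) : Prop :=
  ∃ (t : ℕ) (i : Fin n), Matrix.vecMulVec (1 : Fin n → ℝ) (Pi.single i 1) ∈ wordsLE S t

/-- `max (p W) eᵢᵀ` over the words `W` of length at most `t` and the states `i`: the probability
that Player One wins, when Player Two plays the policy `p`. -/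
def winProb {n : ℕ} (S : Set (Matrix (Fin n) (Fin n) ℝ)) (t : ℕ) (p : Fin n → ℝ) : ℝ :=
  sSup {x | ∃ W ∈ wordsLE S t, ∃ i, x = Matrix.vecMul p W i}

/-- The synchronizing probability function: the minimum of `winProb S t p` over all probability
distributions `p` on the states. -/
def spf {n : ℕ} (S : Set (Matrix (Fin n) (Fin n) ℝ)) (t : ℕ) : ℝ :=
  sInf (winProb S t '' stdSimplex ℝ (Fin n))

/-- The set `A(t)` of reachable vectors: the columns of the words of length at most `t`. -/
def reachable {n : ℕ} (S : Set (Matrix (Fin n) (Fin n) ℝ)) (t : ℕ) : Set (Fin n → ℝ) :=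
  {v | ∃ W ∈ wordsLE S t, ∃ j, v = W.col j}

/-- The number of non-zero entries of a vector. -/
def weight {n : ℕ} (v : Fin n → ℝ) : ℕ :=
  Set.ncard {i | v i ≠ 0}

/-- The triple rendezvous time: the least `t` such that some vector reachable at `t` has weight at
least three. Such a `t` exists for every synchronizing automaton with at least three states. -/
def tripleRendezvousTime {n : ℕ} (S : Set (Matrix (Fin n) (Fin n) ℝ)) : ℕ :=
  sInf {t | ∃ v ∈ reachable S t, 3 ≤ weight v}

end SyncAutomaton

end

/-! Before `T₃` every fibre of a word has at most two states, so the game at time `t` is a linear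
programme on the graph of merged pairs: a distribution `p` keeps the win probability at most `c` iff
`p i ≤ c` for all `i` and `p i + p j ≤ c` on edges. This is a scaled fractional stable set problem.
Its optimum is `2 / (n + s)`, where `s` is the maximum of `|I| - |N(I)|`, and the deficiency form of
Hall's theorem supplies the dual certificate (`exists_matching`). Part 1 follows because an edge
exists once `t ≥ 1`, which excludes `s ≥ n`.

For part 2, complementary slackness makes every certificate constraint tight at every optimal `p`,
so the optimal policies span a space of dimension at most `(n - s) / 2 + 1`
(`finrank_le_of_matching`). While `k` is constant, this span shrinks strictly with `t`: otherwise it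
would be invariant under all letters, the reset word would put a point mass in it, and a point mass
violates the tight equations (`span_feasible_lt`). Hence the dimension at the start bounds the
length of the block, even if the block runs past `T₃`. -/

namespace SyncAutomaton

/-! ### Combinatorics and linear algebra independent of automata -/

open Finset in
/-- Deficiency version of Hall's marriage theorem. -/
theorem exists_injective_sum_of_deficiency {α : Type*} [Fintype α] [DecidableEq α]
    (N : α → Finset α) :
    ∃ (s : ℕ) (I : Finset α) (f : α → α ⊕ Fin s), #I = #(I.biUnion N) + s ∧
      Function.Injective f ∧ ∀ i j, f i = Sum.inl j → j ∈ N i := by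
  obtain ⟨I, -, hI⟩ := Finset.exists_max_image (univ : Finset (Finset α))
    (fun I => (#I : ℤ) - #(I.biUnion N)) univ_nonempty
  have h0 := hI ∅ (mem_univ _)
  simp only [card_empty, biUnion_empty, Nat.cast_zero, sub_zero] at h0
  obtain ⟨s, hs⟩ := Int.eq_ofNat_of_zero_le h0
  -- Giving every vertex the same `s` dummy neighbours makes up the worst deficiency, so Hall's
  -- condition holds.
  have key : ∀ J : Finset α, #J ≤ #(J.biUnion fun i => (N i).disjSum (univ : Finset (Fin s))) := by
    intro J
    rcases J.eq_empty_or_nonempty with rfl | ⟨a, ha⟩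
    · simp
    have hJ := hI J (mem_univ _)
    have hsub : (J.biUnion N).disjSum (univ : Finset (Fin s)) ⊆
        J.biUnion fun i => (N i).disjSum (univ : Finset (Fin s)) := by
      intro z hz
      rcases z with j | k
      · simpa using hz
      · simpa using ⟨a, ha⟩
    have hc := card_le_card hsub
    rw [card_disjSum, card_univ, Fintype.card_fin] at hc
    omega
  obtain ⟨f, hf, hfN⟩ := (Finset.all_card_le_biUnion_card_iff_exists_injective _).1 key
  refine ⟨s, I, f, by omega, hf, fun i j hij => ?_⟩
  have := hfN i
  rw [hij] at this
  simpa using this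

/-- A subspace of functions supported in `D` that change sign along a map injective on `D` has
dimension at most half of the size of `D`. -/
theorem two_mul_finrank_le_card_of_neg {α : Type*} [Fintype α] (K : Submodule ℝ (α → ℝ))
    (D : Finset α) (g : α → α) (hg : Set.InjOn g D) (hneg : ∀ y ∈ K, ∀ i ∈ D, y (g i) = -y i)
    (hzero : ∀ y ∈ K, ∀ i ∉ D, y i = 0) : 2 * Module.finrank ℝ K ≤ D.card := by
  let e : α → Module.Dual ℝ K := fun i => (LinearMap.proj i).comp K.subtype
  have he : ∀ i (y : K), e i y = (y : α → ℝ) i := fun _ _ => rfl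
  -- A maximal independent family of coordinate functionals on `K` separates its points, so it has
  -- at least `finrank K` members. Sign change doubles it inside `D`: the positions `g (a k)` are
  -- new, since `e (a k) = -e (a l)` would contradict independence.
  obtain ⟨κ, a, ha, hspan, hli⟩ := exists_linearIndependent' ℝ e
  have : Finite κ := Finite.of_injective a ha
  have := Fintype.ofFinite κ
  have hfin : Module.finrank ℝ K ≤ Fintype.card κ := by
    let F : K →ₗ[ℝ] (κ → ℝ) := LinearMap.pi fun k => e (a k)
    have hF : Function.Injective F := by
      rw [← LinearMap.ker_eq_bot, LinearMap.ker_eq_bot']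
      intro y hy
      have hle : Submodule.span ℝ (Set.range e) ≤
          LinearMap.ker (LinearMap.applyₗ (R := ℝ) (M₂ := ℝ) y) := by
        rw [← hspan, Submodule.span_le]
        rintro _ ⟨k, rfl⟩
        exact congrFun hy k
      ext i
      exact hle (Submodule.subset_span ⟨i, rfl⟩)
    simpa using LinearMap.finrank_le_finrank_of_injective hF
  have hD : ∀ k, a k ∈ D := fun k => by
    by_contra h
    exact hli.ne_zero k (LinearMap.ext fun y => hzero y y.2 _ h)
  have hgD : ∀ k, g (a k) ∈ D := fun k => by
    by_contra h
    refine hli.ne_zero k (LinearMap.ext fun y => ?_)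
    have h1 := hneg y y.2 _ (hD k)
    rw [hzero y y.2 _ h] at h1
    change (y : α → ℝ) (a k) = 0
    linarith
  have hne : ∀ k l, a k ≠ g (a l) := fun k l h => by
    have hkl : e (a k) + e (a l) = 0 := LinearMap.ext fun y => by
      have h1 := hneg y y.2 _ (hD l)
      rw [← h] at h1
      change (y : α → ℝ) (a k) + (y : α → ℝ) (a l) = 0
      linarith
    by_cases hkl' : k = l
    · subst hkl'
      exact hli.ne_zero k (by simpa [← two_smul ℝ] using hkl)
    · have := (LinearIndepOn.pair_iff (e ∘ a) hkl').1 (hli.linearIndepOn {k, l}) 1 1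
        (by simpa using hkl)
      exact one_ne_zero this.1
  let G : κ ⊕ κ → D := Sum.elim (fun k => ⟨a k, hD k⟩) (fun k => ⟨g (a k), hgD k⟩)
  have hG : Function.Injective G := by
    rintro (k | k) (l | l) h
    · exact congrArg _ (ha (congrArg Subtype.val h))
    · exact absurd (congrArg Subtype.val h) (hne _ _)
    · exact absurd (congrArg Subtype.val h).symm (hne _ _)
    · exact congrArg _ (ha (hg (hD _) (hD _) (congrArg Subtype.val h)))
  have := Fintype.card_le_of_injective G hG
  rw [Fintype.card_sum, Fintype.card_coe] at this
  omega

/-- Weak duality for fractional stable sets, with the condition for equality. -/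
theorem two_mul_sum_le_of_injective {α : Type*} [Fintype α] {s : ℕ} {f : α → α ⊕ Fin s}
    (hf : Function.Injective f) {x : α → ℝ} {c : ℝ} (hc : 0 ≤ c) (hx : ∀ i, x i ≤ c)
    (hxx : ∀ i j, f i = Sum.inl j → x i + x j ≤ c) :
    2 * ∑ i, x i ≤ (Fintype.card α + s) * c ∧
      (2 * ∑ i, x i = (Fintype.card α + s) * c →
        (∀ i, x i + Sum.elim x 0 (f i) = c) ∧ ∀ z ∉ Set.range f, Sum.elim x 0 z = c) := by
  classical
  set g : α ⊕ Fin s → ℝ := Sum.elim x 0 with hg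
  have hgc : ∀ z, g z ≤ c := by
    rintro (j | k)
    · exact hx j
    · exact hc
  have hfc : ∀ i, x i + g (f i) ≤ c := by
    intro i
    rcases h : f i with j | k
    · exact hxx i j h
    · simpa [hg] using hx i
  set T : Finset (α ⊕ Fin s) := Finset.univ.image f with hT
  -- The image of `f` together with the `s` points it misses exhausts the target, on which `x` is
  -- extended by zero.
  have hsum : ∑ i, x i = ∑ i, g (f i) + ∑ z ∈ Tᶜ, g z := by
    have h1 : ∑ z, g z = ∑ i, x i := by simp [hg]
    rw [← h1, ← Finset.sum_add_sum_compl T, hT, Finset.sum_image hf.injOn]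
  have hcard : (Tᶜ.card : ℝ) = s := by
    rw [Finset.card_compl, hT, Finset.card_image_of_injective _ hf]
    simp
  have e1 : ∑ i, (x i + g (f i)) = ∑ i, x i + ∑ i, g (f i) := Finset.sum_add_distrib
  have e2 : ∑ _i : α, c = Fintype.card α * c := by simp
  have e3 : ∑ _z ∈ Tᶜ, c = s * c := by simp [hcard]
  have l1 := Finset.sum_le_sum (s := Finset.univ) fun i _ => hfc i
  have l2 := Finset.sum_le_sum (s := Tᶜ) fun z _ => hgc z
  refine ⟨by linarith, fun heq => ⟨fun i => ?_, fun z hz => ?_⟩⟩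
  · exact (Finset.sum_eq_sum_iff_of_le fun i _ => hfc i).1 (by linarith) i (Finset.mem_univ i)
  · exact (Finset.sum_eq_sum_iff_of_le fun z _ => hgc z).1
      (show ∑ z ∈ Tᶜ, g z = ∑ _z ∈ Tᶜ, c by linarith) z (by simpa [hT] using hz)

/-! ### Words as self-maps of the states -/

variable {n : ℕ} {S : Set (Matrix (Fin n) (Fin n) ℝ)}

/-- The 0/1 matrix of a self-map of `Fin n`. -/
def funMatrix (f : Fin n → Fin n) : Matrix (Fin n) (Fin n) ℝ :=
  Matrix.of fun i j => if f i = j then 1 else 0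

theorem funMatrix_apply (f : Fin n → Fin n) (i j : Fin n) :
    funMatrix f i j = if f i = j then 1 else 0 := rfl

theorem funMatrix_id : funMatrix (id : Fin n → Fin n) = 1 := by
  ext i j
  simp [funMatrix_apply, Matrix.one_apply]

theorem funMatrix_mul (f g : Fin n → Fin n) :
    funMatrix f * funMatrix g = funMatrix (g ∘ f) := by
  ext i j
  simp only [Matrix.mul_apply, funMatrix_apply, ite_mul, one_mul, zero_mul, Finset.sum_ite_eq,
    Finset.mem_univ, if_true, Function.comp_apply]

theorem vecMul_funMatrix (p : Fin n → ℝ) (f : Fin n → Fin n) (j : Fin n) :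
    Matrix.vecMul p (funMatrix f) j = ∑ i with f i = j, p i := by
  simp [Matrix.vecMul, dotProduct, funMatrix_apply, Finset.sum_filter]

theorem vecMul_funMatrix_mem_stdSimplex {p : Fin n → ℝ} (hp : p ∈ stdSimplex ℝ (Fin n))
    (f : Fin n → Fin n) : Matrix.vecMul p (funMatrix f) ∈ stdSimplex ℝ (Fin n) := by
  refine ⟨fun j => ?_, ?_⟩
  · rw [vecMul_funMatrix]
    exact Finset.sum_nonneg fun i _ => hp.1 i
  · simp_rw [vecMul_funMatrix]
    rw [Finset.sum_fiberwise]
    exact hp.2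

theorem exists_eq_funMatrix {L : Matrix (Fin n) (Fin n) ℝ}
    (h01 : ∀ i j, L i j = 0 ∨ L i j = 1) (hrow : ∀ i, ∑ j, L i j = 1) :
    ∃ f, L = funMatrix f := by
  have hex : ∀ i, ∃ j, L i j = 1 := fun i => by
    by_contra! h
    have := hrow i
    rw [Finset.sum_eq_zero fun j _ => (h01 i j).resolve_right (h j)] at this
    exact zero_ne_one this
  choose f hf using hex
  refine ⟨f, ?_⟩
  ext i j
  rw [funMatrix_apply]
  split_ifs with h
  · rw [← h, hf]
  · refine (h01 i j).resolve_right fun h1 => ?_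
    have h2 : ∑ k ∈ {f i, j}, L i k ≤ ∑ k, L i k :=
      Finset.sum_le_sum_of_subset_of_nonneg (Finset.subset_univ _) fun k _ _ => by
        rcases h01 i k with h | h <;> simp [h]
    rw [Finset.sum_pair h, hf, h1, hrow] at h2
    norm_num at h2

theorem IsAutomaton.exists_funMatrix (hS : IsAutomaton S) {L : Matrix (Fin n) (Fin n) ℝ}
    (hL : L ∈ S) : ∃ f, L = funMatrix f :=
  exists_eq_funMatrix (hS L hL).1 (hS L hL).2

theorem one_mem_wordsLE (t : ℕ) : (1 : Matrix (Fin n) (Fin n) ℝ) ∈ wordsLE S t :=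
  ⟨[], by simp, by simp, by simp⟩

theorem wordsLE_mono {t u : ℕ} (h : t ≤ u) : wordsLE S t ⊆ wordsLE S u := by
  rintro W ⟨l, hl, hlen, hW⟩
  exact ⟨l, hl, hlen.trans h, hW⟩

theorem mul_mem_wordsLE {t : ℕ} {L W : Matrix (Fin n) (Fin n) ℝ} (hL : L ∈ S)
    (hW : W ∈ wordsLE S t) : L * W ∈ wordsLE S (t + 1) := by
  obtain ⟨l, hl, hlen, rfl⟩ := hW
  exact ⟨L :: l, by simpa using ⟨hL, hl⟩, by simpa using hlen, by simp⟩

theorem wordsLE_induction {C : Matrix (Fin n) (Fin n) ℝ → Prop} (one : C 1)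
    (mul : ∀ L ∈ S, ∀ W, C W → C (L * W)) {t : ℕ} {W : Matrix (Fin n) (Fin n) ℝ}
    (hW : W ∈ wordsLE S t) : C W := by
  obtain ⟨l, hl, -, rfl⟩ := hW
  induction l with
  | nil => simpa using one
  | cons L l ih =>
    rw [List.prod_cons]
    exact mul L (hl L (by simp)) _ (ih fun M hM => hl M (by simp [hM]))

theorem IsAutomaton.exists_funMatrix_of_mem_wordsLE (hS : IsAutomaton S) {t : ℕ}
    {W : Matrix (Fin n) (Fin n) ℝ} (hW : W ∈ wordsLE S t) : ∃ f, W = funMatrix f := by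
  refine wordsLE_induction (C := fun W => ∃ f, W = funMatrix f) ⟨id, funMatrix_id.symm⟩ ?_ hW
  rintro L hL _ ⟨g, rfl⟩
  obtain ⟨f, rfl⟩ := hS.exists_funMatrix hL
  exact ⟨g ∘ f, funMatrix_mul f g⟩

/-! ### Feasible distributions and attainment of the minimum -/

/-- The distributions against which no word of length at most `t` wins with probability more
than `c`. -/
def feasible (S : Set (Matrix (Fin n) (Fin n) ℝ)) (t : ℕ) (c : ℝ) : Set (Fin n → ℝ) :=
  {p | p ∈ stdSimplex ℝ (Fin n) ∧ ∀ W ∈ wordsLE S t, ∀ i, Matrix.vecMul p W i ≤ c}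

theorem feasible_anti {t u : ℕ} (h : t ≤ u) (c : ℝ) : feasible S u c ⊆ feasible S t c :=
  fun _ hp => ⟨hp.1, fun W hW => hp.2 W (wordsLE_mono h hW)⟩

/-- A word of length `t` played after `L` is a word of length `t + 1`. This is the only link between
consecutive times that part 2 uses besides monotonicity. -/
theorem IsAutomaton.vecMul_mem_feasible (hS : IsAutomaton S) {t : ℕ} {c : ℝ} {p : Fin n → ℝ}
    (hp : p ∈ feasible S (t + 1) c) {L : Matrix (Fin n) (Fin n) ℝ} (hL : L ∈ S) :
    Matrix.vecMul p L ∈ feasible S t c := by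
  obtain ⟨f, hf⟩ := hS.exists_funMatrix hL
  refine ⟨hf ▸ vecMul_funMatrix_mem_stdSimplex hp.1 f, fun W hW i => ?_⟩
  rw [Matrix.vecMul_vecMul]
  exact hp.2 _ (mul_mem_wordsLE hL hW) i

theorem IsAutomaton.vecMul_le_winProb (hS : IsAutomaton S) {t : ℕ} {p : Fin n → ℝ}
    (hp : p ∈ stdSimplex ℝ (Fin n)) {W : Matrix (Fin n) (Fin n) ℝ} (hW : W ∈ wordsLE S t)
    (i : Fin n) : Matrix.vecMul p W i ≤ winProb S t p := by
  -- Entries of a distribution are at most `1`, so the supremum is taken over a bounded set.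
  refine le_csSup ⟨1, ?_⟩ ⟨W, hW, i, rfl⟩
  rintro _ ⟨V, hV, j, rfl⟩
  obtain ⟨f, rfl⟩ := hS.exists_funMatrix_of_mem_wordsLE hV
  have h := vecMul_funMatrix_mem_stdSimplex hp f
  rw [← h.2]
  exact Finset.single_le_sum (fun k _ => h.1 k) (Finset.mem_univ j)

theorem setOf_vecMul_nonempty [NeZero n] (t : ℕ) (p : Fin n → ℝ) :
    {x | ∃ W ∈ wordsLE S t, ∃ i, x = Matrix.vecMul p W i}.Nonempty :=
  ⟨_, 1, one_mem_wordsLE t, 0, rfl⟩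

theorem winProb_le_of_mem_feasible [NeZero n] {t : ℕ} {c : ℝ} {p : Fin n → ℝ}
    (hp : p ∈ feasible S t c) : winProb S t p ≤ c := by
  refine csSup_le (setOf_vecMul_nonempty t p) ?_
  rintro _ ⟨W, hW, i, rfl⟩
  exact hp.2 W hW i

/-- A supremum of linear functions is lower semicontinuous, so it attains its minimum on the compact
simplex. -/
theorem IsAutomaton.isLeast_spf [NeZero n] (hS : IsAutomaton S) (t : ℕ) :
    IsLeast (winProb S t '' stdSimplex ℝ (Fin n)) (spf S t) := by
  have hlsc : LowerSemicontinuousOn (winProb S t) (stdSimplex ℝ (Fin n)) := by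
    intro p _ y hy
    obtain ⟨_, ⟨W, hW, i, rfl⟩, hlt⟩ := exists_lt_of_lt_csSup (setOf_vecMul_nonempty t p) hy
    have hcont : Continuous fun q : Fin n → ℝ => Matrix.vecMul q W i := by
      simp only [Matrix.vecMul, dotProduct]
      fun_prop
    filter_upwards [self_mem_nhdsWithin, nhdsWithin_le_nhds
      (hcont.continuousAt.eventually (lt_mem_nhds hlt))] with q hq hlt'
    exact hlt'.trans_le (hS.vecMul_le_winProb hq hW i)
  obtain ⟨p, hp, hmin⟩ := LowerSemicontinuousOn.exists_isMinOn
    (⟨_, single_mem_stdSimplex ℝ (0 : Fin n)⟩ : (stdSimplex ℝ (Fin n)).Nonempty)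
    (isCompact_stdSimplex ℝ (Fin n)) hlsc
  have hleast : IsLeast (winProb S t '' stdSimplex ℝ (Fin n)) (winProb S t p) := by
    refine ⟨⟨p, hp, rfl⟩, ?_⟩
    rintro _ ⟨q, hq, rfl⟩
    exact hmin hq
  rw [spf, hleast.csInf_eq]
  exact hleast

theorem IsAutomaton.feasible_spf_nonempty [NeZero n] (hS : IsAutomaton S) (t : ℕ) :
    (feasible S t (spf S t)).Nonempty := by
  obtain ⟨p, hp, h⟩ := (hS.isLeast_spf t).1
  exact ⟨p, hp, fun W hW i => h ▸ hS.vecMul_le_winProb hp hW i⟩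

theorem IsAutomaton.spf_eq_of_isLeast [NeZero n] (hS : IsAutomaton S) {t : ℕ} {c : ℝ}
    (h : IsLeast {b | (feasible S t b).Nonempty} c) : spf S t = c := by
  obtain ⟨⟨p, hp⟩, hle⟩ := h
  exact le_antisymm (((hS.isLeast_spf t).2 ⟨p, hp.1, rfl⟩).trans
    (winProb_le_of_mem_feasible hp)) (hle (hS.feasible_spf_nonempty t))

/-! ### Merged pairs and the linear programme before `T₃` -/

/-- Two distinct states are mapped to the same state by a word of length at most `t`. -/
def Merge (S : Set (Matrix (Fin n) (Fin n) ℝ)) (t : ℕ) (i j : Fin n) : Prop :=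
  i ≠ j ∧ ∃ W ∈ wordsLE S t, ∃ k, W i k = 1 ∧ W j k = 1

theorem Merge.symm {t : ℕ} {i j : Fin n} (h : Merge S t i j) : Merge S t j i :=
  let ⟨hne, W, hW, k, hi, hj⟩ := h
  ⟨hne.symm, W, hW, k, hj, hi⟩

theorem card_fiber_le_two {t : ℕ}
    (ht : t < tripleRendezvousTime S) {f : Fin n → Fin n} (hf : funMatrix f ∈ wordsLE S t)
    (k : Fin n) : (Finset.univ.filter fun i => f i = k).card ≤ 2 := by
  by_contra! h
  refine Nat.notMem_of_lt_sInf ht ⟨_, ⟨_, hf, k, rfl⟩, ?_⟩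
  have : {i | (funMatrix f).col k i ≠ 0} = ↑(Finset.univ.filter fun i => f i = k) := by
    ext i
    simp [Matrix.col, funMatrix_apply]
  rw [weight, this, Set.ncard_coe_finset]
  exact h

/-- Fibres have at most two elements, so each entry of `p W` is zero, a single `p i`, or a sum over
a merged pair. -/
theorem IsAutomaton.mem_feasible_iff (hS : IsAutomaton S) {t : ℕ}
    (ht : t < tripleRendezvousTime S) {c : ℝ} {p : Fin n → ℝ} (hp : p ∈ stdSimplex ℝ (Fin n))
    (hc : 0 ≤ c) :
    p ∈ feasible S t c ↔ (∀ i, p i ≤ c) ∧ ∀ i j, Merge S t i j → p i + p j ≤ c := by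
  constructor
  · intro h
    refine ⟨fun i => by simpa using h.2 1 (one_mem_wordsLE t) i, ?_⟩
    rintro i j ⟨hij, W, hW, k, hi, hj⟩
    obtain ⟨f, rfl⟩ := hS.exists_funMatrix_of_mem_wordsLE hW
    refine le_trans ?_ (h.2 _ hW k)
    rw [vecMul_funMatrix, ← Finset.sum_pair hij]
    refine Finset.sum_le_sum_of_subset_of_nonneg ?_ fun l _ _ => hp.1 l
    simp only [funMatrix_apply, ite_eq_left_iff, zero_ne_one, imp_false, not_not] at hi hj
    intro l
    simp only [Finset.mem_insert, Finset.mem_singleton, Finset.mem_filter, Finset.mem_univ,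
      true_and]
    rintro (rfl | rfl) <;> assumption
  · rintro ⟨h1, h2⟩
    refine ⟨hp, fun W hW k => ?_⟩
    obtain ⟨f, rfl⟩ := hS.exists_funMatrix_of_mem_wordsLE hW
    rw [vecMul_funMatrix]
    have hcard := card_fiber_le_two ht hW k
    set F := Finset.univ.filter fun i => f i = k with hF
    have hmem : ∀ i ∈ F, f i = k := fun i hi => (Finset.mem_filter.1 hi).2
    interval_cases hc' : F.card
    · rw [Finset.card_eq_zero.1 hc', Finset.sum_empty]
      exact hc
    · obtain ⟨i, hi⟩ := Finset.card_eq_one.1 hc'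
      rw [hi, Finset.sum_singleton]
      exact h1 i
    · obtain ⟨i, j, hij, hi⟩ := Finset.card_eq_two.1 hc'
      rw [hi, Finset.sum_pair hij]
      refine h2 i j ⟨hij, _, hW, k, ?_, ?_⟩ <;> rw [funMatrix_apply, if_pos (hmem _ (by simp [hi]))]

/-- Without a merged pair every letter is injective, hence so is every word, including the reset
word. -/
theorem exists_merge (hn : 2 ≤ n) (hS : IsAutomaton S) (hsync : IsSynchronizing S) {t : ℕ}
    (ht : 1 ≤ t) : ∃ i j, Merge S t i j := by
  by_contra! h
  have hinj : ∀ f, funMatrix f ∈ S → Function.Injective f := by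
    intro f hf i j hij
    by_contra hne
    refine h i j ⟨hne, funMatrix f, ?_, f i, ?_, ?_⟩
    · exact wordsLE_mono ht ⟨[funMatrix f], by simpa using hf, by simp, by simp⟩
    · simp [funMatrix_apply]
    · simp [funMatrix_apply, hij]
  obtain ⟨u, k, hu⟩ := hsync
  obtain ⟨g, hg, hgW⟩ := wordsLE_induction
    (C := fun W => ∃ f, Function.Injective f ∧ W = funMatrix f)
    ⟨id, Function.injective_id, funMatrix_id.symm⟩ (by
      rintro L hL _ ⟨g, hg, rfl⟩
      obtain ⟨f, rfl⟩ := hS.exists_funMatrix hL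
      exact ⟨g ∘ f, hg.comp (hinj f hL), funMatrix_mul f g⟩) hu
  have hk : ∀ i, g i = k := fun i => by
    have := congrFun (congrFun hgW i) k
    simpa [Matrix.vecMulVec_apply, funMatrix_apply] using this.symm
  have := @hg ⟨0, by omega⟩ ⟨1, by omega⟩ ((hk _).trans (hk _).symm)
  simp at this

/-- Before the triple rendezvous time `k(t) = 2 / (n + s)`, and this value is certified by a
partial matching of merged pairs that leaves `s` states unmatched. -/
theorem IsAutomaton.exists_matching [NeZero n] (hS : IsAutomaton S) {t : ℕ}
    (ht : t < tripleRendezvousTime S) :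
    ∃ (s : ℕ) (f : Fin n → Fin n ⊕ Fin s), Function.Injective f ∧
      (∀ i j, f i = Sum.inl j → Merge S t i j) ∧ spf S t = 2 / ((n : ℝ) + s) ∧
      ((∃ i j, Merge S t i j) → s ≤ n - 1) := by
  classical
  obtain ⟨s, I, f, hI, hf, hfN⟩ := exists_injective_sum_of_deficiency
    fun i => Finset.univ.filter fun j => Merge S t i j
  have hmerge : ∀ i j, f i = Sum.inl j → Merge S t i j := fun i j h => by simpa using hfN i j h
  set NI := I.biUnion fun i => Finset.univ.filter fun j => Merge S t i j with hNI
  have hmemNI : ∀ i j, i ∈ I → Merge S t i j → j ∈ NI := fun i j hi hij => by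
    simpa [hNI] using ⟨i, hi, hij⟩
  have hn : 0 < (n : ℝ) := Nat.cast_pos.2 (NeZero.pos n)
  have hns : 0 < (n : ℝ) + s := by positivity
  refine ⟨s, f, hf, hmerge, ?_, ?_⟩
  · refine hS.spf_eq_of_isLeast ⟨?_, ?_⟩
    -- The primal optimum is half-integral after scaling: the indicator of `I` plus that of the
    -- complement of `N(I)`. Edges respect the bound `2` because a neighbour of a state in `I` lies
    -- in `N(I)`.
    · set w : Fin n → ℝ := fun i => (if i ∈ I then 1 else 0) + if i ∈ NI then 0 else 1 with hw
      have hw0 : ∀ i, 0 ≤ w i := fun i => by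
        simp only [hw]
        split_ifs <;> norm_num
      have hw2 : ∀ i, w i ≤ 2 := fun i => by
        simp only [hw]
        split_ifs <;> norm_num
      have hww : ∀ i j, Merge S t i j → w i + w j ≤ 2 := fun i j hij => by
        have h1 := hmemNI i j
        have h2 := hmemNI j i
        simp only [hij, hij.symm, true_implies] at h1 h2
        simp only [hw]
        split_ifs <;> first | (exfalso; tauto) | norm_num
      have hsum : ∑ i, w i = n + s := by
        have h2 : ∑ i, (if i ∈ NI then (0 : ℝ) else 1) = n - NI.card := by
          have : ∀ i, (if i ∈ NI then (0 : ℝ) else 1) = 1 - if i ∈ NI then 1 else 0 := fun i => by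
            split_ifs <;> norm_num
          simp [this, Finset.sum_sub_distrib]
        have hIr : (I.card : ℝ) = NI.card + s := by exact_mod_cast hI
        simp only [hw, Finset.sum_add_distrib, h2]
        simp [hIr]
        ring
      have hmem : (fun i => w i / (n + s)) ∈ stdSimplex ℝ (Fin n) :=
        ⟨fun i => div_nonneg (hw0 i) hns.le, by
          rw [← Finset.sum_div, hsum, div_self hns.ne']⟩
      refine ⟨_, (hS.mem_feasible_iff ht hmem (by positivity)).2 ⟨fun i => ?_, fun i j hij => ?_⟩⟩
      · exact div_le_div_of_nonneg_right (hw2 i) hns.le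
      · rw [← add_div]
        exact div_le_div_of_nonneg_right (hww i j hij) hns.le
    · rintro c ⟨p, hp⟩
      have hc : 0 ≤ c := (hp.1.1 0).trans (by simpa using hp.2 1 (one_mem_wordsLE t) 0)
      obtain ⟨h1, h2⟩ := (hS.mem_feasible_iff ht hp.1 hc).1 hp
      have := (two_mul_sum_le_of_injective hf hc h1 fun i j h => h2 i j (hmerge i j h)).1
      rw [hp.1.2, Fintype.card_fin] at this
      rw [div_le_iff₀ hns]
      linarith
  · rintro ⟨i, j, hij⟩
    -- If `s ≥ n`, then `I` is everything and `N(I)` is empty, so there are no edges.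
    by_contra! hs
    have hle := Finset.card_le_univ I
    rw [Fintype.card_fin] at hle
    have h0 : NI.card = 0 := by omega
    have hIu : I = Finset.univ := (Finset.card_eq_iff_eq_univ I).1 (by rw [Fintype.card_fin]; omega)
    have := hmemNI i j (hIu ▸ Finset.mem_univ i) hij
    rw [Finset.card_eq_zero.1 h0] at this
    simp at this

/-! ### Dimension of the span of optimal policies, and its strict decrease -/

/-- The functions that satisfy the equality constraints of a matching have a space of dimension at
most half of the number of matched states, plus one. -/
theorem finrank_le_of_matching {s : ℕ} {c : ℝ} {f : Fin n → Fin n ⊕ Fin s}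
    (hf : Function.Injective f) (hr : ∀ k, Sum.inr k ∈ Set.range f)
    (M : Submodule ℝ (Fin n → ℝ))
    (hM : ∀ x ∈ M, ∀ i, x i + Sum.elim x 0 (f i) = c * ∑ k, x k) :
    Module.finrank ℝ M ≤ (n - s) / 2 + 1 := by
  classical
  choose r hr using hr
  have hrinj : Function.Injective r := fun k l h => by
    have := hr k
    rw [h, hr l] at this
    exact (Sum.inr_injective this).symm
  -- `D` consists of the states matched to genuine states; the states `r k` are matched to dummies.
  set D : Finset (Fin n) := (Finset.univ.image r)ᶜ with hD
  have hDcard : D.card = n - s := by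
    rw [hD, Finset.card_compl, Finset.card_image_of_injective _ hrinj]
    simp
  have hDinl : ∀ i ∈ D, ∃ j, f i = Sum.inl j := fun i hi => by
    rcases h : f i with j | k
    · exact ⟨j, rfl⟩
    · have : r k = i := hf ((hr k).trans h.symm)
      simp only [hD, Finset.mem_compl, Finset.mem_image, Finset.mem_univ, true_and] at hi
      exact absurd ⟨k, this⟩ hi
  let g : Fin n → Fin n := fun i => Sum.elim id (fun _ => i) (f i)
  have hg : ∀ i ∈ D, f i = Sum.inl (g i) := fun i hi => by
    obtain ⟨j, hj⟩ := hDinl i hi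
    simp [g, hj]
  let σ : M →ₗ[ℝ] ℝ := (∑ i, LinearMap.proj i : (Fin n → ℝ) →ₗ[ℝ] ℝ).comp M.subtype
  have hσ : ∀ y : M, σ y = ∑ i, (y : Fin n → ℝ) i := fun y => by simp [σ]
  -- On the sum-zero part of `M` the equations become homogeneous: `y` changes sign along `g` on `D`
  -- and vanishes off `D`. Rank-nullity for the sum then costs one more dimension.
  have hK : 2 * Module.finrank ℝ ((LinearMap.ker σ).map M.subtype) ≤ D.card := by
    have hsum : ∀ y ∈ (LinearMap.ker σ).map M.subtype, y ∈ M ∧ ∑ i, y i = 0 := by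
      rintro _ ⟨y, hy, rfl⟩
      exact ⟨y.2, (hσ y).symm.trans hy⟩
    refine two_mul_finrank_le_card_of_neg _ D g ?_ ?_ ?_
    · intro i hi j hj hij
      exact hf (by rw [hg i hi, hg j hj, hij])
    · intro y hy i hi
      have := hM y (hsum y hy).1 i
      rw [(hsum y hy).2, hg i hi, Sum.elim_inl] at this
      linarith
    · intro y hy i hi
      simp only [hD, Finset.mem_compl, not_not, Finset.mem_image, Finset.mem_univ,
        true_and] at hi
      obtain ⟨k, rfl⟩ := hi
      have := hM y (hsum y hy).1 (r k)
      rw [(hsum y hy).2, hr] at this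
      simpa using this
  rw [LinearEquiv.finrank_eq (Submodule.equivMapOfInjective _ M.injective_subtype _).symm] at hK
  have hrn := LinearMap.finrank_range_add_finrank_ker σ
  have hle : Module.finrank ℝ (LinearMap.range σ) ≤ 1 := by
    simpa using Submodule.finrank_le (LinearMap.range σ)
  omega

/-- If a letter-invariant subspace contains a distribution, it contains a point mass. -/
theorem exists_single_mem_of_invariant (hsync : IsSynchronizing S)
    {M : Submodule ℝ (Fin n → ℝ)} (hM : ∀ L ∈ S, ∀ x ∈ M, Matrix.vecMul x L ∈ M)
    {p : Fin n → ℝ} (hp : p ∈ M) (hp1 : ∑ i, p i = 1) : ∃ i, Pi.single i 1 ∈ M := by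
  obtain ⟨t, i, hW⟩ := hsync
  have := wordsLE_induction (C := fun W => ∀ x ∈ M, Matrix.vecMul x W ∈ M)
    (by simp) (fun L hL W hW x hx => by
      rw [← Matrix.vecMul_vecMul]
      exact hW _ (hM L hL x hx)) hW p hp
  rw [Matrix.vecMul_vecMulVec] at this
  refine ⟨i, ?_⟩
  simpa [dotProduct, hp1] using this

/-- Letters carry the span at `t + 1` into the span at `t`, so equality would make the span
invariant. -/
theorem IsAutomaton.span_feasible_lt (hS : IsAutomaton S) (hsync : IsSynchronizing S) {t : ℕ}
    {c : ℝ} (hne : (feasible S t c).Nonempty)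
    (hsingle : ∀ i, Pi.single i 1 ∉ Submodule.span ℝ (feasible S t c)) :
    Submodule.span ℝ (feasible S (t + 1) c) < Submodule.span ℝ (feasible S t c) := by
  refine lt_of_le_of_ne (Submodule.span_mono (feasible_anti t.le_succ c)) fun heq => ?_
  obtain ⟨p, hp⟩ := hne
  obtain ⟨i, hi⟩ := exists_single_mem_of_invariant hsync (fun L hL x hx => by
    rw [← heq] at hx
    induction hx using Submodule.span_induction with
    | mem x hx => exact Submodule.subset_span (hS.vecMul_mem_feasible hx hL)
    | zero => simp
    | add x y _ _ hx hy =>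
      rw [Matrix.add_vecMul]
      exact add_mem hx hy
    | smul a x _ hx =>
      rw [Matrix.smul_vecMul]
      exact Submodule.smul_mem _ a hx) (Submodule.subset_span hp) hp.1.2
  exact hsingle i hi

/-- The dimension drops by at least one per step, and the last span is still nonzero because it
contains a distribution. -/
theorem IsAutomaton.length_le_finrank_span_feasible (hS : IsAutomaton S)
    (hsync : IsSynchronizing S) {t m : ℕ} {c : ℝ}
    (hne : ∀ j < m, (feasible S (t + j) c).Nonempty)
    (hsingle : ∀ i, Pi.single i 1 ∉ Submodule.span ℝ (feasible S t c)) :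
    m ≤ Module.finrank ℝ (Submodule.span ℝ (feasible S t c)) := by
  have key : ∀ j < m, Module.finrank ℝ (Submodule.span ℝ (feasible S (t + j) c)) + j ≤
      Module.finrank ℝ (Submodule.span ℝ (feasible S t c)) := by
    intro j
    induction j with
    | zero => simp
    | succ j ih =>
      intro hj
      have h1 := ih (by omega)
      have h2 := Submodule.finrank_lt_finrank_of_lt
        (hS.span_feasible_lt hsync (hne j (by omega)) fun i hi => hsingle i
          (Submodule.span_mono (feasible_anti (Nat.le_add_right t j) c) hi))
      rw [add_assoc] at h2
      omega
  rcases m with - | m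
  · exact Nat.zero_le _
  obtain ⟨p, hp⟩ := hne m (Nat.lt_succ_self m)
  have hp0 : p ≠ 0 := by
    rintro rfl
    simpa using hp.1.2
  have : 0 < Module.finrank ℝ (Submodule.span ℝ (feasible S (t + m) c)) :=
    Module.finrank_pos_iff_exists_ne_zero.2
      ⟨⟨p, Submodule.subset_span hp⟩, fun h => hp0 (congrArg Subtype.val h)⟩
  have := key m (Nat.lt_succ_self m)
  omega

theorem IsAutomaton.length_le_of_spf_eq (hn : 3 ≤ n) (hS : IsAutomaton S)
    (hsync : IsSynchronizing S) {s t m : ℕ} (ht : t < tripleRendezvousTime S)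
    (h : ∀ j < m, spf S (t + j) = 2 / ((n : ℝ) + s)) : m ≤ (n - s) / 2 + 1 := by
  have : NeZero n := ⟨by omega⟩
  rcases m.eq_zero_or_pos with rfl | hm
  · exact Nat.zero_le _
  obtain ⟨s', f, hf, hmerge, hspf, -⟩ := hS.exists_matching ht
  have hn3 : (3 : ℝ) ≤ n := by exact_mod_cast hn
  have hns : 0 < (n : ℝ) + s := by positivity
  have hss : s = s' := by
    have h0 := h 0 hm
    rw [add_zero, hspf, div_eq_div_iff (by positivity) hns.ne'] at h0
    have : (s : ℝ) = s' := by linarith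
    exact_mod_cast this
  subst hss
  set c : ℝ := 2 / ((n : ℝ) + s) with hc
  have hc0 : 0 < c := by positivity
  -- This is where `n ≥ 3` matters: it makes point masses violate the tight equations.
  have hc1 : c < 1 := by
    rw [hc, div_lt_one hns]
    have : (0 : ℝ) ≤ s := Nat.cast_nonneg s
    linarith
  have hne : ∀ j < m, (feasible S (t + j) c).Nonempty := fun j hj => by
    rw [← h j hj]
    exact hS.feasible_spf_nonempty _
  have htight : ∀ p ∈ feasible S t c, (∀ i, p i + Sum.elim p 0 (f i) = c) ∧
      ∀ z ∉ Set.range f, Sum.elim p 0 z = c := fun p hp => by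
    obtain ⟨h1, h2⟩ := (hS.mem_feasible_iff ht hp.1 hc0.le).1 hp
    refine (two_mul_sum_le_of_injective hf hc0.le h1 fun i j h => h2 i j (hmerge i j h)).2 ?_
    rw [hp.1.2, Fintype.card_fin, hc]
    field_simp
  set M := Submodule.span ℝ (feasible S t c) with hM
  let ev : Fin n ⊕ Fin s → (Fin n → ℝ) →ₗ[ℝ] ℝ := Sum.elim (fun j => LinearMap.proj j) 0
  have hev : ∀ z x, ev z x = Sum.elim x 0 z := by
    rintro (j | k) x <;> simp [ev]
  let tot : (Fin n → ℝ) →ₗ[ℝ] ℝ := c • ∑ i, LinearMap.proj i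
  have htot : ∀ x, tot x = c * ∑ i, x i := fun x => by simp [tot]
  -- Multiplying `c` by the total mass makes the tight equations homogeneous, so they pass to the
  -- span.
  have h1 : ∀ x ∈ M, ∀ i, x i + Sum.elim x 0 (f i) = c * ∑ k, x k := fun x hx i => by
    have hle : M ≤ LinearMap.eqLocus (LinearMap.proj i + ev (f i)) tot := by
      refine Submodule.span_le.2 fun p hp => ?_
      simpa [hev, htot, hp.1.2] using (htight p hp).1 i
    simpa [hev, htot] using hle hx
  -- For a point mass the left side of the equation at state `0` is `0` or `1`, since a state is
  -- never matched to itself, whereas `0 < c < 1`.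
  have hsingle : ∀ i, Pi.single i 1 ∉ M := fun i hi => by
    have h0 := h1 _ hi 0
    rw [Finset.sum_pi_single', if_pos (Finset.mem_univ i), mul_one] at h0
    rcases hf0 : f 0 with j | k
    · have hj := (hmerge 0 j hf0).1
      rw [hf0, Sum.elim_inl] at h0
      simp only [Pi.single_apply] at h0
      split_ifs at h0 with ha hb
      · exact hj (ha.trans hb.symm)
      all_goals linarith
    · rw [hf0] at h0
      simp only [Pi.single_apply, Sum.elim_inr, Pi.zero_apply] at h0
      split_ifs at h0 <;> linarith
  obtain ⟨p, hp⟩ := hne 0 hm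
  refine (hS.length_le_finrank_span_feasible hsync hne hsingle).trans
    (finrank_le_of_matching hf (fun k => ?_) M h1)
  -- A dummy outside the range of `f` would have to carry the value `c > 0`, but dummies carry `0`.
  by_contra hk
  exact hc0.ne ((htight p hp).2 _ hk)

end SyncAutomaton

theorem mainTheorem2 (n : ℕ) (hn : 3 ≤ n) (S : Set (Matrix (Fin n) (Fin n) ℝ))
    (hS : SyncAutomaton.IsAutomaton S) (hsync : SyncAutomaton.IsSynchronizing S) :
    (∀ t : ℕ, 1 ≤ t → t < SyncAutomaton.tripleRendezvousTime S →
      ∃ s : ℕ, s ≤ n - 1 ∧ SyncAutomaton.spf S t = 2 / ((n : ℝ) + (s : ℝ))) ∧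
    (∀ s : ℕ, s ≤ n - 1 → ∀ t m : ℕ, t < SyncAutomaton.tripleRendezvousTime S →
      (∀ j : ℕ, j < m → SyncAutomaton.spf S (t + j) = 2 / ((n : ℝ) + (s : ℝ))) →
      m ≤ (n - s) / 2 + 1) := by
  refine ⟨fun t ht1 ht => ?_, fun s _ t m ht h => hS.length_le_of_spf_eq hn hsync ht h⟩
  have : NeZero n := ⟨by omega⟩
  obtain ⟨s, -, -, -, hspf, hs⟩ := hS.exists_matching ht
  exact ⟨s, hs (SyncAutomaton.exists_merge (by omega) hS hsync ht1), hspf⟩
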